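/- Let two nested cubes in $\mathbb{R}^3$ have a common center and parallel edges, the outer one with edge $a>0$ and the inner one with edge $ta$, where $0<t<1$. Place a mass $\mu_1$ at each vertex of the outer cube and a mass $\mu_2$ at each vertex of the inner cube; here $\mu_1,\mu_2$ are positive or, more generally, real numbers with $\mu_2\neq 0$ and $\mu_1+\mu_2\neq 0$. A configuration $q_1,\dots,q_N\in\mathbb{R}^3$ with masses $m_1,\dots,m_N$ and center of mass $q_0$ is called central if there is $\lambda\in\mathbb{R}$ with $-\lambda(q_i-q_0)=\sum_{j\ne i} m_j\frac{q_j-q_i}{|q_j-q_i|^3}$ for all $i$. Put $$\gamma_1(t)=-\Big((2\sqrt3+9\sqrt2+18)t-\tfrac{72(t^2+6t+1)}{(3t^2+2t+3)^{3/2}}+\tfrac{72(t^2-6t+1)}{(3t^2-2t+3)^{3/2}}-\tfrac{8\sqrt3}{t+1}-\tfrac{8\sqrt3}{t-1}+\tfrac{2\sqrt3+9\sqrt2+18}{t^2}\Big),$$ $$\begin{aligned}\gamma_0(t)=&-\tfrac{9(3t+1)(t+3)}{(3t^2+2t+3)^3}+\tfrac{9(3t-1)(t-3)}{(3t^2-2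t+3)^3}+\tfrac{6\sqrt3\sqrt2+12\sqrt3+54\sqrt2+83}{96t^2}\\&-\tfrac{4\sqrt3}{(3t^2+2t+3)^{3/2}(t+1)}-\tfrac{2\sqrt3}{(3t^2-2t+3)^{3/2}(t+1)}-\tfrac{2\sqrt3}{(3t^2+2t+3)^{3/2}(t-1)}-\tfrac{4\sqrt3}{(3t^2-2t+3)^{3/2}(t-1)}\\&-\tfrac{144t}{(3t^2+2t+3)^{3/2}(3t^2-2t+3)^{3/2}}-\tfrac1{3(t+1)^4}+\tfrac1{3(t-1)^4},\end{aligned}$$ and $c(t)=-\gamma_0(t)/\gamma_1(t)$. Then $\gamma_1(t)<0$, $\gamma_0(t)>0$ (so $c(t)>0$) and $24c(t)-\tfrac1{12}\sqrt3-\tfrac38\sqrt2-\tfrac34>0$, and the configuration of the sixteen vertices is central if and only if $$\frac{\mu_1}{\mu_2}=-\frac{24c(t)-\frac{\sqrt3t+\sqrt3}{3(t+1)^3}-\frac{3(t+3)}{(3t^2+2t+3)^{3/2}}+\frac{3(t-3)}{(3t^2-2t+3)^{3/2}}-\frac{\sqrt3t-\sqrt3}{3(t-1)^3}}{24c(t)-\frac1{12}\sqrt3-\frac38\sqrt2-\frac34}.$$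 -/

import Mathlib

open Real

noncomputable section

/-- Center of mass `(∑ mⱼ qⱼ) / (∑ mⱼ)` of finitely many point masses (meaningful when the total
mass is nonzero). -/
def centerOfMass {ι E : Type*} [Fintype ι] [NormedAddCommGroup E] [NormedSpace ℝ E]
    (m : ι → ℝ) (q : ι → E) : E :=
  (∑ j, m j)⁻¹ • ∑ j, m j • q j

/-- The configuration `q` with masses `m` is central for the Newtonian N-body problem: for some
real `lam`, every body satisfies
`-lam (qᵢ - q₀) = ∑_{j ≠ i} mⱼ (qⱼ - qᵢ) / |qⱼ - qᵢ|³`, with `q₀` the center of mass. -/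
def IsCentralConfiguration {ι E : Type*} [Fintype ι] [DecidableEq ι]
    [NormedAddCommGroup E] [NormedSpace ℝ E] (m : ι → ℝ) (q : ι → E) : Prop :=
  ∃ lam : ℝ, ∀ i, -lam • (q i - centerOfMass m q) =
    ∑ j ∈ Finset.univ.erase i, (m j / ‖q j - q i‖ ^ 3) • (q j - q i)

/-- Labels of the eight vertices of a cube: a choice of sign for each of the three axes. -/
abbrev CubeLabel : Type := Fin 3 → Bool

/-- The vertex with label `s` of the cube with center `o`, edge length `a`, and edges parallel to
the orthonormal frame `e`. -/
def cubeVertex (o : EuclideanSpace ℝ (Fin 3))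
    (e : OrthonormalBasis (Fin 3) ℝ (EuclideanSpace ℝ (Fin 3))) (a : ℝ) (s : CubeLabel) :
    EuclideanSpace ℝ (Fin 3) :=
  o + ∑ k, (if s k then a / 2 else -(a / 2)) • e k

/-- The sixteen vertices of two homothetic nested cubes with common center `o` and frame `e`:
the outer cube (left summand) has edge `a`, the inner cube (right summand) has edge `t * a`. -/
def nestedCubes (o : EuclideanSpace ℝ (Fin 3))
    (e : OrthonormalBasis (Fin 3) ℝ (EuclideanSpace ℝ (Fin 3))) (a t : ℝ) :
    CubeLabel ⊕ CubeLabel → EuclideanSpace ℝ (Fin 3) :=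
  Sum.elim (cubeVertex o e a) (cubeVertex o e (t * a))

/-- Masses that are equal on each cube: `μ₁` on the outer cube and `μ₂` on the inner cube. -/
def nestedCubesMass (μ₁ μ₂ : ℝ) : CubeLabel ⊕ CubeLabel → ℝ :=
  Sum.elim (fun _ => μ₁) (fun _ => μ₂)

def cubeGamma₁ (t : ℝ) : ℝ :=
  -((2 * √3 + 9 * √2 + 18) * t
    - 72 * (t ^ 2 + 6 * t + 1) / (3 * t ^ 2 + 2 * t + 3) ^ (3 / 2 : ℝ)
    + 72 * (t ^ 2 - 6 * t + 1) / (3 * t ^ 2 - 2 * t + 3) ^ (3 / 2 : ℝ)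
    - 8 * √3 / (t + 1) - 8 * √3 / (t - 1)
    + (2 * √3 + 9 * √2 + 18) / t ^ 2)

def cubeGamma₀ (t : ℝ) : ℝ :=
  -(9 * (3 * t + 1) * (t + 3) / (3 * t ^ 2 + 2 * t + 3) ^ 3)
    + 9 * (3 * t - 1) * (t - 3) / (3 * t ^ 2 - 2 * t + 3) ^ 3
    + (6 * √3 * √2 + 12 * √3 + 54 * √2 + 83) / (96 * t ^ 2)
    - 4 * √3 / ((3 * t ^ 2 + 2 * t + 3) ^ (3 / 2 : ℝ) * (t + 1))
    - 2 * √3 / ((3 * t ^ 2 - 2 * t + 3) ^ (3 / 2 : ℝ) * (t + 1))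
    - 2 * √3 / ((3 * t ^ 2 + 2 * t + 3) ^ (3 / 2 : ℝ) * (t - 1))
    - 4 * √3 / ((3 * t ^ 2 - 2 * t + 3) ^ (3 / 2 : ℝ) * (t - 1))
    - 144 * t / ((3 * t ^ 2 + 2 * t + 3) ^ (3 / 2 : ℝ) * (3 * t ^ 2 - 2 * t + 3) ^ (3 / 2 : ℝ))
    - 1 / (3 * (t + 1) ^ 4) + 1 / (3 * (t - 1) ^ 4)

def cubeC (t : ℝ) : ℝ := -cubeGamma₀ t / cubeGamma₁ t

/-- Numerator in the formula for the mass ratio. -/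
def cubeRatioNum (t : ℝ) : ℝ :=
  24 * cubeC t - (√3 * t + √3) / (3 * (t + 1) ^ 3)
    - 3 * (t + 3) / (3 * t ^ 2 + 2 * t + 3) ^ (3 / 2 : ℝ)
    + 3 * (t - 3) / (3 * t ^ 2 - 2 * t + 3) ^ (3 / 2 : ℝ)
    - (√3 * t - √3) / (3 * (t - 1) ^ 3)

/-- Denominator in the formula for the mass ratio. -/
def cubeRatioDen (t : ℝ) : ℝ :=
  24 * cubeC t - 1 / 12 * √3 - 3 / 8 * √2 - 3 / 4

end

/-! By symmetry each cube pulls every vertex along that vertex's own diagonal, so the vector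
equations collapse to two scalar ones, one per cube. Write α for `selfPull`, β for `innerPull t`, δ
for `outerPull t`, with half-edges scaled to 1 and t. The equations are l = μ₁ α + μ₂ β and l t = μ₁
δ + μ₂ α / t². Eliminating l gives μ₁ (α t - δ) = -μ₂ (β t - α / t²).

Put P = α t + α / t² - β t - δ. Then γ₁ = -72 P and γ₀ = 9 (α² / t² - β δ), and the denominator and
numerator of the ratio factor as 3 (β - α)(α t - δ) / P and 3 (β - α)(β t - α / t²) / P. Their
quotient is the eliminated equation.

What remains is four inequalities on 0 < t < 1: P > 0 (`pull_sum_lt`), β δ < α² / t²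
(`innerPull_mul_outerPull_lt`), δ < α t (`outerPull_lt`) and α < β (`innerPull_gt` with
`selfPull_bounds`). They follow from rational bounds on √2 and √3 and the tangent estimate
`tangent_le_sqrt_cube`. -/

/-- The sign `±1` of a Boolean. -/
noncomputable def boolSign (b : Bool) : ℝ := if b then 1 else -1

theorem boolSign_beq (b c : Bool) : boolSign (b == c) = boolSign b * boolSign c := by
  cases b <;> cases c <;> norm_num [boolSign]

theorem boolSign_mul_self (b : Bool) : boolSign b * boolSign b = 1 := by
  cases b <;> norm_num [boolSign]

theorem sum_cubeLabel {M : Type*} [AddCommMonoid M] (f : CubeLabel → M) :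
    ∑ s, f s = ∑ x : Bool, ∑ y : Bool, ∑ z : Bool, f ![x, y, z] := by
  let φ : CubeLabel ≃ Bool × Bool × Bool :=
    { toFun := fun s => (s 0, s 1, s 2)
      invFun := fun p => ![p.1, p.2.1, p.2.2]
      left_inv := fun s => by ext k; fin_cases k <;> rfl
      right_inv := fun _ => rfl }
  rw [← φ.symm.sum_comp, Fintype.sum_prod_type]
  simp only [Fintype.sum_prod_type]
  rfl

/-- Componentwise comparison with a fixed label, an involution of the labels. -/
def beqLabel (i : CubeLabel) : CubeLabel ≃ CubeLabel where
  toFun s := fun k => i k == s k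
  invFun s := fun k => i k == s k
  left_inv s := funext fun k => by
    show (i k == (i k == s k)) = s k
    cases i k <;> cases s k <;> rfl
  right_inv s := funext fun k => by
    show (i k == (i k == s k)) = s k
    cases i k <;> cases s k <;> rfl

/-! ### Symmetry reduction to two scalar equations. -/

section Geometry

variable (o : EuclideanSpace ℝ (Fin 3))
  (e : OrthonormalBasis (Fin 3) ℝ (EuclideanSpace ℝ (Fin 3)))

/-- The diagonal of the frame with the given signs. -/
noncomputable def signDiagonal (i : CubeLabel) : EuclideanSpace ℝ (Fin 3) :=
  ∑ k, boolSign (i k) • e k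

theorem signDiagonal_ne_zero (i : CubeLabel) : signDiagonal e i ≠ 0 := by
  intro h
  have h0 := congrArg (fun v => inner ℝ (e 0) v) h
  simp only [signDiagonal, inner_zero_right, e.orthonormal.inner_right_fintype] at h0
  have := boolSign_mul_self (i 0)
  rw [h0] at this
  norm_num at this

theorem cubeVertex_eq (a : ℝ) (s : CubeLabel) :
    cubeVertex o e a s = o + (a / 2) • signDiagonal e s := by
  simp only [cubeVertex, signDiagonal, Finset.smul_sum, smul_smul]
  congr 1
  refine Finset.sum_congr rfl fun k _ => ?_
  congr 1
  cases s k <;> simp [boolSign]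

theorem sum_signDiagonal : ∑ s, signDiagonal e s = 0 := by
  simp only [signDiagonal]
  rw [Finset.sum_comm]
  refine Finset.sum_eq_zero fun k _ => ?_
  rw [← Finset.sum_smul, sum_cubeLabel]
  fin_cases k <;> norm_num [boolSign]

theorem sum_cubeVertex (a : ℝ) : ∑ s, cubeVertex o e a s = (8 : ℝ) • o := by
  simp only [cubeVertex_eq, Finset.sum_add_distrib, ← Finset.smul_sum, sum_signDiagonal]
  simp [← Nat.cast_smul_eq_nsmul ℝ]

theorem centerOfMass_nestedCubes (a t μ₁ μ₂ : ℝ) (hM : μ₁ + μ₂ ≠ 0) :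
    centerOfMass (nestedCubesMass μ₁ μ₂) (nestedCubes o e a t) = o := by
  simp only [centerOfMass, nestedCubesMass, nestedCubes, Fintype.sum_sum_type, Sum.elim_inl,
    Sum.elim_inr, ← Finset.smul_sum, sum_cubeVertex]
  simp only [Finset.sum_const, smul_smul, ← add_smul]
  have : (8 : ℝ) * μ₁ + 8 * μ₂ ≠ 0 := by
    rw [← mul_add]; positivity
  simp only [Finset.card_univ, Fintype.card_pi, Fintype.card_bool, Finset.prod_const,
    Fintype.card_fin, nsmul_eq_mul]
  norm_num
  rw [show (8 * μ₁ + 8 * μ₂)⁻¹ * (μ₁ * 8 + μ₂ * 8) = 1 by field_simp, one_smul]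

/-- Signed strength of the attraction, along its diagonal, of the vertex of a cube of half-edge `q`
by a concentric cube of half-edge `p` with unit masses. -/
noncomputable def cubePull (p q : ℝ) : ℝ :=
  (p - q) / √(3 * (p - q) ^ 2) ^ 3 + (p - 3 * q) / √(2 * (p - q) ^ 2 + (p + q) ^ 2) ^ 3
    - (p + 3 * q) / √((p - q) ^ 2 + 2 * (p + q) ^ 2) ^ 3 - (p + q) / √(3 * (p + q) ^ 2) ^ 3

theorem norm_sum_smul_frame (c : Fin 3 → ℝ) :
    ‖∑ k, c k • e k‖ = √(∑ k, c k ^ 2) := by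
  rw [← e.repr.norm_map, EuclideanSpace.norm_eq]
  congr 1
  refine Finset.sum_congr rfl fun k _ => ?_
  rw [e.repr_apply_apply, e.orthonormal.inner_right_fintype, Real.norm_eq_abs, sq_abs]

/-- Labelling sources by their agreement with `i` pulls the signs of `i` out of the displacement, so
distances no longer depend on `i`. -/
theorem cubeVertex_beq_sub (b c : ℝ) (i s : CubeLabel) :
    cubeVertex o e b (beqLabel i s) - cubeVertex o e c i =
      ∑ k, (boolSign (i k) * (b / 2 * boolSign (s k) - c / 2)) • e k := by
  rw [cubeVertex_eq, cubeVertex_eq, add_sub_add_left_eq_sub, signDiagonal, signDiagonal,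
    Finset.smul_sum, Finset.smul_sum, ← Finset.sum_sub_distrib]
  refine Finset.sum_congr rfl fun k _ => ?_
  rw [smul_smul, smul_smul, ← sub_smul]
  congr 1
  show b / 2 * boolSign (i k == s k) - _ = _
  rw [boolSign_beq]
  ring

/-- The sources split as 1 + 3 + 3 + 1 by the number of signs shared with `i`. Summing each group
makes all components along the signed frame equal, which gives the four terms of `cubePull`. -/
theorem sum_cube_attraction (m b c : ℝ) (i : CubeLabel) :
    ∑ j, (m / ‖cubeVertex o e b j - cubeVertex o e c i‖ ^ 3) •
        (cubeVertex o e b j - cubeVertex o e c i) =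
      (m * cubePull (b / 2) (c / 2)) • signDiagonal e i := by
  rw [← (beqLabel i).sum_comp]
  simp only [cubeVertex_beq_sub, norm_sum_smul_frame, Finset.smul_sum, smul_smul, mul_pow,
    pow_two (boolSign _), boolSign_mul_self, one_mul]
  rw [Finset.sum_comm, signDiagonal, Finset.smul_sum]
  refine Finset.sum_congr rfl fun k _ => ?_
  rw [← Finset.sum_smul, smul_smul]
  congr 1
  generalize b / 2 = p
  generalize c / 2 = q
  have h1 : (p - q) * (p - q) + (p - q) * (p - q) + (p - q) * (p - q) = 3 * (p - q) ^ 2 := by ring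
  have h2 : (-p - q) * (-p - q) + (-p - q) * (-p - q) + (-p - q) * (-p - q) = 3 * (p + q) ^ 2 := by
    ring
  have h3 : (p - q) * (p - q) + (p - q) * (p - q) + (-p - q) * (-p - q) =
    2 * (p - q) ^ 2 + (p + q) ^ 2 := by ring
  have h4 : (p - q) * (p - q) + (-p - q) * (-p - q) + (p - q) * (p - q) =
    2 * (p - q) ^ 2 + (p + q) ^ 2 := by ring
  have h5 : (-p - q) * (-p - q) + (p - q) * (p - q) + (p - q) * (p - q) =
    2 * (p - q) ^ 2 + (p + q) ^ 2 := by ring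
  have h6 : (-p - q) * (-p - q) + (-p - q) * (-p - q) + (p - q) * (p - q) =
    (p - q) ^ 2 + 2 * (p + q) ^ 2 := by ring
  have h7 : (-p - q) * (-p - q) + (p - q) * (p - q) + (-p - q) * (-p - q) =
    (p - q) ^ 2 + 2 * (p + q) ^ 2 := by ring
  have h8 : (p - q) * (p - q) + (-p - q) * (-p - q) + (-p - q) * (-p - q) =
    (p - q) ^ 2 + 2 * (p + q) ^ 2 := by ring
  rw [sum_cubeLabel, cubePull]
  fin_cases k <;>
  · simp [Fin.sum_univ_three, boolSign, pow_two (_ - _), h1, h2, h3, h4, h5, h6, h7, h8]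
    ring_nf

/-- Inverse-square scaling. -/
theorem cubePull_smul {h : ℝ} (hh : 0 < h) (p q : ℝ) :
    cubePull (h * p) (h * q) = cubePull p q / h ^ 2 := by
  have key (x y : ℝ) (n : ℝ) (hn : n = h ^ 2 * y) : h * x / √n ^ 3 = x / √y ^ 3 / h ^ 2 := by
    rw [hn, Real.sqrt_mul (sq_nonneg h), Real.sqrt_sq hh.le, mul_pow, div_div]
    rw [show h ^ 3 * √y ^ 3 = h * (√y ^ 3 * h ^ 2) by ring, mul_div_mul_left _ _ hh.ne']
  have k1 := key (p - q) (3 * (p - q) ^ 2) (3 * (h * p - h * q) ^ 2) (by ring)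
  have k2 := key (p - 3 * q) (2 * (p - q) ^ 2 + (p + q) ^ 2)
    (2 * (h * p - h * q) ^ 2 + (h * p + h * q) ^ 2) (by ring)
  have k3 := key (p + 3 * q) ((p - q) ^ 2 + 2 * (p + q) ^ 2)
    ((h * p - h * q) ^ 2 + 2 * (h * p + h * q) ^ 2) (by ring)
  have k4 := key (p + q) (3 * (p + q) ^ 2) (3 * (h * p + h * q) ^ 2) (by ring)
  rw [cubePull, cubePull]
  linear_combination k1 + k2 - k3 - k4

theorem isCentralConfiguration_nestedCubes_iff {a t μ₁ μ₂ : ℝ} (ha : 0 < a)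
    (hM : μ₁ + μ₂ ≠ 0) :
    IsCentralConfiguration (nestedCubesMass μ₁ μ₂) (nestedCubes o e a t) ↔
      ∃ l : ℝ, -l = μ₁ * cubePull 1 1 + μ₂ * cubePull t 1 ∧
        -l * t = μ₁ * cubePull 1 t + μ₂ * cubePull t t := by
  have hh : 0 < a / 2 := by positivity
  have e2 : t * a / 2 = a / 2 * t := by ring
  have p11 := cubePull_smul hh 1 1
  have pt1 := cubePull_smul hh t 1
  have p1t := cubePull_smul hh 1 t
  have ptt := cubePull_smul hh t t
  have hsub (c : ℝ) (i : CubeLabel) : cubeVertex o e c i - o = (c / 2) • signDiagonal e i := by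
    rw [cubeVertex_eq, add_sub_cancel_left]
  -- The self term has zero displacement, so it may be put back and each cube summed in full.
  have force (i : CubeLabel ⊕ CubeLabel) :
      ∑ j ∈ Finset.univ.erase i,
        (nestedCubesMass μ₁ μ₂ j / ‖nestedCubes o e a t j - nestedCubes o e a t i‖ ^ 3) •
          (nestedCubes o e a t j - nestedCubes o e a t i) =
      ∑ j, (nestedCubesMass μ₁ μ₂ j / ‖nestedCubes o e a t j - nestedCubes o e a t i‖ ^ 3) •
          (nestedCubes o e a t j - nestedCubes o e a t i) :=
    Finset.sum_erase _ (by rw [sub_self, smul_zero])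
  have cancel (x y : ℝ) (i : CubeLabel) :
      x • signDiagonal e i = y • signDiagonal e i ↔ x = y :=
    (smul_left_injective ℝ (signDiagonal_ne_zero e i)).eq_iff
  simp only [IsCentralConfiguration, centerOfMass_nestedCubes o e a t μ₁ μ₂ hM, force]
  simp only [Fintype.sum_sum_type, Sum.forall, nestedCubes, nestedCubesMass, Sum.elim_inl, Sum.elim_inr,
    sum_cube_attraction, hsub, smul_smul, ← add_smul, cancel, forall_const]
  rw [mul_one] at p11 pt1 p1t
  rw [e2, p11, pt1, p1t, ptt]
  generalize cubePull 1 1 = x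
  generalize cubePull t 1 = y
  generalize cubePull 1 t = z
  generalize cubePull t t = w
  generalize a / 2 = h at hh
  have hne := hh.ne'
  constructor
  · rintro ⟨l, h1, h2⟩
    -- Positions scale by `h` and forces by `h⁻²`, so the multiplier scales by `h ^ 3`.
    refine ⟨l * h ^ 3, ?_, ?_⟩
    · field_simp at h1
      linear_combination h1
    · field_simp at h2
      linear_combination h2
  · rintro ⟨l, h1, h2⟩
    refine ⟨l / h ^ 3, ?_, ?_⟩
    · field_simp
      linear_combination h1
    · field_simp
      linear_combination h2

end Geometry

/-! ### Closed forms of the pulls and of γ₀, γ₁. -/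

theorem rpow_three_halves {x : ℝ} (hx : 0 ≤ x) : x ^ (3 / 2 : ℝ) = √x ^ 3 := by
  rw [Real.sqrt_eq_rpow, ← Real.rpow_natCast, ← Real.rpow_mul hx]
  norm_num

/-- Tangent line of the convex function x^(3/2) at x = 4: with s = √x, the difference is (s - 2)² (s
+ 1). -/
theorem tangent_le_sqrt_cube {x : ℝ} (hx : 0 ≤ x) : 3 * x - 4 ≤ √x ^ 3 := by
  have h := Real.sq_sqrt hx
  nlinarith [mul_nonneg (sq_nonneg (√x - 2)) (add_nonneg (Real.sqrt_nonneg x) zero_le_one)]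

theorem sqrt_three_mul_sq_cube {y : ℝ} (hy : 0 ≤ y) : √(3 * y ^ 2) ^ 3 = 3 * √3 * y ^ 3 := by
  rw [Real.sqrt_mul (by norm_num), Real.sqrt_sq hy, mul_pow, pow_succ √3, Real.sq_sqrt (by norm_num)]

/-- Strength of the attraction of a cube on its own vertices, for half-edge `1`. -/
noncomputable def selfPull : ℝ := 1 / 4 + √2 / 8 + √3 / 36

/-- Strength of the attraction of the inner cube on the vertices of the outer one. -/
noncomputable def innerPull (t : ℝ) : ℝ :=
  √3 / (9 * (1 - t) ^ 2) + (3 - t) / √(3 * t ^ 2 - 2 * t + 3) ^ 3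
    + (3 + t) / √(3 * t ^ 2 + 2 * t + 3) ^ 3 + √3 / (9 * (1 + t) ^ 2)

/-- Strength of the attraction of the outer cube on the vertices of the inner one. -/
noncomputable def outerPull (t : ℝ) : ℝ :=
  √3 / (9 * (1 + t) ^ 2) - √3 / (9 * (1 - t) ^ 2) + (1 + 3 * t) / √(3 * t ^ 2 + 2 * t + 3) ^ 3
    + (3 * t - 1) / √(3 * t ^ 2 - 2 * t + 3) ^ 3

theorem cubePull_one_one : cubePull 1 1 = -selfPull := by
  have h4 : √(4 : ℝ) = 2 := by
    rw [show (4 : ℝ) = 2 ^ 2 by norm_num, Real.sqrt_sq (by norm_num)]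
  have h8 : √(8 : ℝ) = 2 * √2 := by
    rw [show (8 : ℝ) = 2 ^ 2 * 2 by norm_num, Real.sqrt_mul (by norm_num),
      Real.sqrt_sq (by norm_num)]
  have h12 : √(12 : ℝ) = 2 * √3 := by
    rw [show (12 : ℝ) = 2 ^ 2 * 3 by norm_num, Real.sqrt_mul (by norm_num),
      Real.sqrt_sq (by norm_num)]
  have s2 : √(2 : ℝ) ^ 2 = 2 := Real.sq_sqrt (by norm_num)
  have s3 : √(3 : ℝ) ^ 2 = 3 := Real.sq_sqrt (by norm_num)
  have h2 : √(2 : ℝ) ≠ 0 := by positivity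
  have h3 : √(3 : ℝ) ≠ 0 := by positivity
  have e2 : (1 : ℝ) / √2 ^ 3 = √2 / 4 := by
    field_simp
    linear_combination (-√2 ^ 2 - 2) * s2
  have e3 : (1 : ℝ) / √3 ^ 3 = √3 / 9 := by
    field_simp
    linear_combination (-√3 ^ 2 - 3) * s3
  have : cubePull 1 1 = -(1 / 4) - 1 / 2 * (1 / √2 ^ 3) - 1 / 4 * (1 / √3 ^ 3) := by
    norm_num [cubePull, h4, h8, h12, mul_pow]
    ring
  rw [this, e2, e3, selfPull]
  ring

theorem div_three_mul_sqrt_three {y : ℝ} (hy : y ≠ 0) :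
    y / (3 * √3 * y ^ 3) = √3 / (9 * y ^ 2) := by
  have s3 : √(3 : ℝ) ^ 2 = 3 := Real.sq_sqrt (by norm_num)
  have h3 : √(3 : ℝ) ≠ 0 := by positivity
  field_simp
  linear_combination -3 * s3

section Bounds

variable {t : ℝ}

theorem cubePull_self (ht₀ : 0 < t) : cubePull t t = -selfPull / t ^ 2 := by
  rw [← cubePull_one_one, ← cubePull_smul ht₀, mul_one]

theorem cubePull_inner (ht₀ : 0 < t) (ht₁ : t < 1) : cubePull t 1 = -innerPull t := by
  have h1 : 0 < 1 - t := sub_pos.2 ht₁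
  have h2 : 0 < 1 + t := by linarith
  rw [cubePull, innerPull, ← div_three_mul_sqrt_three h1.ne', ← div_three_mul_sqrt_three h2.ne',
    show (t - 1) ^ 2 = (1 - t) ^ 2 by ring, add_comm t 1, sqrt_three_mul_sq_cube h1.le,
    sqrt_three_mul_sq_cube h2.le,
    show 2 * (1 - t) ^ 2 + (1 + t) ^ 2 = 3 * t ^ 2 - 2 * t + 3 by ring,
    show (1 - t) ^ 2 + 2 * (1 + t) ^ 2 = 3 * t ^ 2 + 2 * t + 3 by ring]
  ring

theorem cubePull_outer (ht₀ : 0 < t) (ht₁ : t < 1) : cubePull 1 t = -outerPull t := by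
  have h1 : 0 < 1 - t := sub_pos.2 ht₁
  have h2 : 0 < 1 + t := by linarith
  rw [cubePull, outerPull, ← div_three_mul_sqrt_three h1.ne', ← div_three_mul_sqrt_three h2.ne',
    sqrt_three_mul_sq_cube h1.le, sqrt_three_mul_sq_cube h2.le,
    show 2 * (1 - t) ^ 2 + (1 + t) ^ 2 = 3 * t ^ 2 - 2 * t + 3 by ring,
    show (1 - t) ^ 2 + 2 * (1 + t) ^ 2 = 3 * t ^ 2 + 2 * t + 3 by ring]
  ring

theorem cubeGamma₁_eq (ht₀ : 0 < t) (ht₁ : t < 1) :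
    cubeGamma₁ t = -72 * (selfPull * t + selfPull / t ^ 2 - innerPull t * t - outerPull t) := by
  have h1 : 1 - t ≠ 0 := (sub_pos.2 ht₁).ne'
  have h1' : t - 1 ≠ 0 := (sub_neg.2 ht₁).ne
  have h2 : t + 1 ≠ 0 := by positivity
  have h2' : 1 + t ≠ 0 := by positivity
  have e1 : 8 * √3 / (t + 1) = 72 * (√3 / (9 * (1 + t) ^ 2) * (t + 1)) := by
    field_simp
    ring
  have e2 : 8 * √3 / (t - 1) = 72 * (√3 / (9 * (1 - t) ^ 2) * (t - 1)) := by
    field_simp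
    ring
  rw [cubeGamma₁, rpow_three_halves (by nlinarith), rpow_three_halves (by nlinarith), e1, e2,
    selfPull, innerPull, outerPull]
  ring

theorem cubeGamma₀_eq (ht₀ : 0 < t) (ht₁ : t < 1) :
    cubeGamma₀ t = 9 * (selfPull ^ 2 / t ^ 2 - innerPull t * outerPull t) := by
  have h1 : 1 - t ≠ 0 := (sub_pos.2 ht₁).ne'
  have h2' : 1 + t ≠ 0 := by positivity
  have s2 : √(2 : ℝ) ^ 2 = 2 := Real.sq_sqrt (by norm_num)
  have s3 : √(3 : ℝ) ^ 2 = 3 := Real.sq_sqrt (by norm_num)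
  have hp : 0 < 3 * t ^ 2 + 2 * t + 3 := by nlinarith
  have hm : 0 < 3 * t ^ 2 - 2 * t + 3 := by nlinarith
  have cube {x : ℝ} (hx : 0 < x) : x ^ 3 = (√x ^ 3) ^ 2 := by
    rw [← pow_mul, mul_comm 3 2, pow_mul, Real.sq_sqrt hx.le]
  rw [cubeGamma₀, rpow_three_halves hp.le, rpow_three_halves hm.le, cube hp, cube hm,
    selfPull, innerPull, outerPull]
  -- With radicals and reciprocals as free variables, this is a polynomial identity modulo c² = 3,
  -- d² = 2, (1 + t) U = 1 and (1 - t) V = 1.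
  generalize √(3 * t ^ 2 + 2 * t + 3) ^ 3 = A
  generalize √(3 * t ^ 2 - 2 * t + 3) ^ 3 = B
  generalize √3 = c at s3
  generalize √2 = d at s2
  have f1 : (1 + t) * (1 + t)⁻¹ = 1 := mul_inv_cancel₀ h2'
  have f2 : (1 - t) * (1 - t)⁻¹ = 1 := mul_inv_cancel₀ h1
  rw [add_comm t 1, ← neg_sub 1 t]
  simp only [div_eq_mul_inv, mul_inv, ← inv_pow, inv_neg]
  generalize (1 + t)⁻¹ = U at f1
  generalize (1 - t)⁻¹ = V at f2
  generalize A⁻¹ = X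
  generalize B⁻¹ = Y
  linear_combination (4 * c * X * U + 2 * c * Y * U) * f1 - (2 * c * X * V + 4 * c * Y * V) * f2
    + (U ^ 4 - V ^ 4) / 9 * s3 - 9 * (t⁻¹) ^ 2 * (s2 / 64 + s3 / 1296)

/-! ### Numerical estimates. -/

theorem selfPull_bounds : 47 / 100 < selfPull ∧ selfPull < 48 / 100 := by
  have h2 := Real.sqrt_lt_sqrt (by norm_num) (show (1.41 ^ 2 : ℝ) < 2 by norm_num)
  have h2' := Real.sqrt_lt_sqrt (by norm_num) (show (2 : ℝ) < 1.42 ^ 2 by norm_num)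
  have h3 := Real.sqrt_lt_sqrt (by norm_num) (show (1.73 ^ 2 : ℝ) < 3 by norm_num)
  have h3' := Real.sqrt_lt_sqrt (by norm_num) (show (3 : ℝ) < 1.74 ^ 2 by norm_num)
  rw [Real.sqrt_sq (by norm_num)] at h2 h2' h3 h3'
  rw [selfPull]
  constructor <;> linarith

theorem one_div_sqrt_cube_le {x : ℝ} (hx : 0 < 3 * x - 4) : 1 / √x ^ 3 ≤ 1 / (3 * x - 4) :=
  one_div_le_one_div_of_le hx (tangent_le_sqrt_cube (by linarith))

theorem inv_sqrt_cube_add_le (ht₀ : 0 < t) :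
    1 / √(3 * t ^ 2 + 2 * t + 3) ^ 3 ≤ 1 / (5 + 6 * t) :=
  (one_div_sqrt_cube_le (by nlinarith)).trans
    (one_div_le_one_div_of_le (by linarith) (by nlinarith))

theorem inv_sqrt_cube_sub_le (t : ℝ) : 1 / √(3 * t ^ 2 - 2 * t + 3) ^ 3 ≤ 1 / 4 :=
  (one_div_sqrt_cube_le (by nlinarith [sq_nonneg (3 * t - 1)])).trans
    (one_div_le_one_div_of_le (by norm_num) (by nlinarith [sq_nonneg (3 * t - 1)]))

theorem inv_sqrt_cube_add_le_sub (ht₀ : 0 < t) :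
    1 / √(3 * t ^ 2 + 2 * t + 3) ^ 3 ≤ 1 / √(3 * t ^ 2 - 2 * t + 3) ^ 3 := by
  have h : 0 < 3 * t ^ 2 - 2 * t + 3 := by nlinarith [sq_nonneg (3 * t - 1)]
  refine one_div_le_one_div_of_le (by positivity) ?_
  gcongr
  linarith

theorem sqrt_three_bounds : 173 / 100 < √3 ∧ √3 < 174 / 100 :=
  ⟨Real.lt_sqrt_of_sq_lt (by norm_num), (Real.sqrt_lt' (by norm_num)).2 (by norm_num)⟩

/-- The radical terms equal (X - Y) + 3t (X + Y), where X ≤ Y and X + Y ≤ 2/5; the two √3 terms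
combine to -(4√3/9) t / (1 - t²)². -/
theorem outerPull_le (ht₀ : 0 < t) (ht₁ : t < 1) :
    outerPull t ≤ t * (6 / 5 - 76 / 100 / (1 - t ^ 2) ^ 2) := by
  have h1 : 0 < 1 - t := sub_pos.2 ht₁
  have h2 : 0 < 1 + t := by linarith
  have h3 : 0 < 1 - t ^ 2 := by nlinarith
  have hm : 0 < 5 - 6 * t + 9 * t ^ 2 := by nlinarith [sq_nonneg (3 * t - 1)]
  have hX : 1 / √(3 * t ^ 2 + 2 * t + 3) ^ 3 ≤ 1 / (5 + 6 * t + 9 * t ^ 2) :=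
    (one_div_sqrt_cube_le (by nlinarith)).trans_eq (by congr 1; ring)
  have hY : 1 / √(3 * t ^ 2 - 2 * t + 3) ^ 3 ≤ 1 / (5 - 6 * t + 9 * t ^ 2) :=
    (one_div_sqrt_cube_le (by linarith)).trans_eq (by congr 1; ring)
  have hXY := inv_sqrt_cube_add_le_sub ht₀
  have hsum : 1 / (5 + 6 * t + 9 * t ^ 2) + 1 / (5 - 6 * t + 9 * t ^ 2) ≤ 2 / 5 := by
    rw [div_add_div _ _ (by positivity) hm.ne', div_le_div_iff₀ (by positivity) (by norm_num)]
    nlinarith [sq_nonneg t, sq_nonneg (t ^ 2)]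
  have hc : 76 / 100 ≤ 4 * √3 / 9 := by linarith [sqrt_three_bounds.1]
  have hk : 76 / 100 / (1 - t ^ 2) ^ 2 ≤ 4 * √3 / 9 / (1 - t ^ 2) ^ 2 := by gcongr
  have he : √3 / (9 * (1 + t) ^ 2) - √3 / (9 * (1 - t) ^ 2) =
      -(t * (4 * √3 / 9 / (1 - t ^ 2) ^ 2)) := by
    rw [show 1 - t ^ 2 = (1 + t) * (1 - t) by ring]
    field_simp
    ring
  rw [outerPull, he, div_eq_mul_one_div (1 + 3 * t), div_eq_mul_one_div (3 * t - 1)]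
  generalize 1 / √(3 * t ^ 2 + 2 * t + 3) ^ 3 = X at *
  generalize 1 / √(3 * t ^ 2 - 2 * t + 3) ^ 3 = Y at *
  nlinarith [mul_le_mul_of_nonneg_left hk ht₀.le,
    mul_le_mul_of_nonneg_left (show X + Y ≤ 2 / 5 by linarith) ht₀.le]

theorem outerPull_le_mul (ht₀ : 0 < t) (ht₁ : t < 1) : outerPull t ≤ 44 / 100 * t := by
  have h3 : 0 < 1 - t ^ 2 := by nlinarith
  have h : 76 / 100 ≤ 76 / 100 / (1 - t ^ 2) ^ 2 := by
    rw [le_div_iff₀ (by positivity)]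
    nlinarith [sq_nonneg t]
  nlinarith [outerPull_le ht₀ ht₁, mul_le_mul_of_nonneg_left h ht₀.le]

theorem innerPull_gt (ht₀ : 0 < t) (ht₁ : t < 1) : 1 / 2 < innerPull t := by
  have h1 : 0 < 1 - t := sub_pos.2 ht₁
  have hp : 0 < 3 * t ^ 2 + 2 * t + 3 := by positivity
  have hm : 0 < 3 * t ^ 2 - 2 * t + 3 := by nlinarith [sq_nonneg (3 * t - 1)]
  have hA : √(3 * t ^ 2 + 2 * t + 3) ≤ 3 := Real.sqrt_le_iff.2 ⟨by norm_num, by nlinarith⟩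
  have hB : √(3 * t ^ 2 - 2 * t + 3) ≤ 2 := Real.sqrt_le_iff.2 ⟨by norm_num, by nlinarith⟩
  have k1 : 2 / 2 ^ 3 ≤ (3 - t) / √(3 * t ^ 2 - 2 * t + 3) ^ 3 := by
    gcongr
    all_goals linarith
  have k2 : 3 / 3 ^ 3 ≤ (3 + t) / √(3 * t ^ 2 + 2 * t + 3) ^ 3 := by
    gcongr
    linarith
  have k3 : √3 / (9 * 1 ^ 2) ≤ √3 / (9 * (1 - t) ^ 2) := by
    gcongr
    linarith
  have k4 : 0 < √3 / (9 * (1 + t) ^ 2) := by positivity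
  rw [innerPull]
  linarith [sqrt_three_bounds.1]

theorem innerPull_le (ht₀ : 0 < t) (ht₁ : t ≤ 46 / 100) : innerPull t ≤ 24 / 10 := by
  have hX := inv_sqrt_cube_add_le ht₀
  have hX' : 1 / (5 + 6 * t) ≤ 1 / 5 := one_div_le_one_div_of_le (by norm_num) (by linarith)
  have hY := inv_sqrt_cube_sub_le t
  have hs := sqrt_three_bounds.2
  have k1 : √3 / (9 * (1 - t) ^ 2) ≤ 174 / 100 / (9 * (54 / 100) ^ 2) := by
    gcongr
    linarith
  have k2 : √3 / (9 * (1 + t) ^ 2) ≤ 174 / 100 / (9 * 1 ^ 2) := by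
    gcongr
    linarith
  rw [innerPull, div_eq_mul_one_div (3 - t), div_eq_mul_one_div (3 + t)]
  nlinarith [mul_le_mul_of_nonneg_left hY (show 0 ≤ 3 - t by linarith),
    mul_le_mul_of_nonneg_left (hX.trans hX') (show 0 ≤ 3 + t by linarith)]

theorem outerPull_lt (ht₀ : 0 < t) (ht₁ : t < 1) : outerPull t < selfPull * t :=
  (outerPull_le_mul ht₀ ht₁).trans_lt
    (mul_lt_mul_of_pos_right (by linarith [selfPull_bounds.1]) ht₀)

theorem innerPull_mul_outerPull_lt (ht₀ : 0 < t) (ht₁ : t < 1) :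
    innerPull t * outerPull t < selfPull ^ 2 / t ^ 2 := by
  have hI := innerPull_gt ht₀ ht₁
  have hα := selfPull_bounds.1
  rcases le_or_gt (outerPull t) 0 with h | h
  · exact (mul_nonpos_of_nonneg_of_nonpos (by linarith) h).trans_lt (by positivity)
  have h3 : 0 < 1 - t ^ 2 := by nlinarith
  have h4 : 76 / 100 / (1 - t ^ 2) ^ 2 < 6 / 5 :=
    sub_pos.1 (pos_of_mul_pos_right (h.trans_le (outerPull_le ht₀ ht₁)) ht₀.le)
  rw [div_lt_iff₀ (by positivity)] at h4
  -- A positive outer pull forces (1 - t²)² > 19/30, hence small t, where crude constants suffice.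
  have ht : t < 46 / 100 := by
    by_contra! hc
    have h5 : 1 - t ^ 2 ≤ 789 / 1000 := by nlinarith
    nlinarith
  have hβ := innerPull_le ht₀ ht.le
  calc innerPull t * outerPull t ≤ 24 / 10 * (44 / 100 * t) := by
        gcongr
        exact outerPull_le_mul ht₀ ht₁
    _ ≤ 1 := by linarith
    _ < (47 / 100) ^ 2 / (46 / 100) ^ 2 := by norm_num
    _ ≤ selfPull ^ 2 / t ^ 2 := by gcongr

theorem pull_sum_lt (ht₀ : 0 < t) (ht₁ : t < 1) :
    innerPull t * t + outerPull t < selfPull * t + selfPull / t ^ 2 := by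
  have h1 : 0 < 1 - t := sub_pos.2 ht₁
  have h2 : 0 < 1 + t := by linarith
  have h3 : 0 < 1 - t ^ 2 := by nlinarith
  have hX := inv_sqrt_cube_add_le ht₀
  have hY := inv_sqrt_cube_sub_le t
  have hXY := inv_sqrt_cube_add_le_sub ht₀
  have hα := selfPull_bounds.1
  have hs := sqrt_three_bounds.1
  -- Tangent lines at t = 3/4, exact for the two convex terms and slightly rounded up for the
  -- concave one in `hsix`, leave an affine inequality on (0, 1).
  have hinv : 16 / 9 - 128 / 27 * (t - 3 / 4) ≤ 1 / t ^ 2 := by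
    rw [le_div_iff₀ (by positivity)]
    nlinarith [mul_nonneg (sq_nonneg (4 * t - 3)) (show 0 ≤ 8 * t + 3 by linarith)]
  have hfrac : 12 / 7 + 400 / 49 * (t - 3 / 4) ≤ t / (1 - t ^ 2) := by
    rw [le_div_iff₀ h3]
    nlinarith [mul_nonneg (sq_nonneg (4 * t - 3)) (show 0 ≤ 25 * t + 24 by linarith)]
  have hfrac₀ : 0 < t / (1 - t ^ 2) := by positivity
  have hsix : 6 * t * (1 / (5 + 6 * t)) ≤ 225 / 1000 + 333 / 1000 * t := by
    rw [mul_one_div, div_le_iff₀ (by positivity)]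
    nlinarith [sq_nonneg (4 * t - 3)]
  have he : √3 / (9 * (1 + t) ^ 2) - √3 / (9 * (1 - t) ^ 2) + √3 / (9 * (1 - t) ^ 2) * t
      + √3 / (9 * (1 + t) ^ 2) * t = -(2 * √3 / 9 * (t / (1 - t ^ 2))) := by
    rw [show 1 - t ^ 2 = (1 + t) * (1 - t) by ring]
    field_simp
    ring
  have k1 : 47 / 100 * (1 / t ^ 2) ≤ selfPull * (1 / t ^ 2) := by gcongr
  have k2 : 47 / 100 * t ≤ selfPull * t := by gcongr
  have k3 : 384 / 1000 * (t / (1 - t ^ 2)) ≤ 2 * √3 / 9 * (t / (1 - t ^ 2)) :=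
    mul_le_mul_of_nonneg_right (by linarith) hfrac₀.le
  rw [innerPull, outerPull, div_eq_mul_one_div (3 - t), div_eq_mul_one_div (3 + t),
    div_eq_mul_one_div (1 + 3 * t), div_eq_mul_one_div (3 * t - 1), div_eq_mul_one_div selfPull]
  generalize 1 / √(3 * t ^ 2 + 2 * t + 3) ^ 3 = X at *
  generalize 1 / √(3 * t ^ 2 - 2 * t + 3) ^ 3 = Y at *
  have k4 : 6 * t * X ≤ 6 * t * (1 / (5 + 6 * t)) := by gcongr
  have k5 : 6 * t * Y ≤ 6 * t * (1 / 4) := by gcongr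
  -- The radical terms of β t + δ total 6t (X + Y) - (1 + t²)(Y - X); the last part is discarded.
  have k6 : 0 ≤ (1 + t ^ 2) * (Y - X) := mul_nonneg (by positivity) (by linarith)
  linarith

end Bounds

/-! ### The mass ratio. -/

theorem cubeRatioNum_eq {t : ℝ} (ht₀ : 0 < t) (ht₁ : t < 1) :
    cubeRatioNum t = 24 * cubeC t - 3 * innerPull t := by
  have h1 : 1 - t ≠ 0 := (sub_pos.2 ht₁).ne'
  have h1' : t - 1 ≠ 0 := (sub_neg.2 ht₁).ne
  have h2 : t + 1 ≠ 0 := by positivity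
  have h2' : 1 + t ≠ 0 := by positivity
  have e1 : (√3 * t + √3) / (3 * (t + 1) ^ 3) = 3 * (√3 / (9 * (1 + t) ^ 2)) := by
    field_simp
    ring
  have e2 : (√3 * t - √3) / (3 * (t - 1) ^ 3) = 3 * (√3 / (9 * (1 - t) ^ 2)) := by
    field_simp
    ring
  rw [cubeRatioNum, rpow_three_halves (by nlinarith), rpow_three_halves (by nlinarith), e1, e2,
    innerPull]
  ring

theorem cubeRatioDen_eq (t : ℝ) : cubeRatioDen t = 24 * cubeC t - 3 * selfPull := by
  rw [cubeRatioDen, selfPull]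
  ring

theorem mainTheorem6 (o : EuclideanSpace ℝ (Fin 3))
    (e : OrthonormalBasis (Fin 3) ℝ (EuclideanSpace ℝ (Fin 3)))
    (a t μ₁ μ₂ : ℝ) (ha : 0 < a) (ht₀ : 0 < t) (ht₁ : t < 1)
    (hμ₂ : μ₂ ≠ 0) (hM : μ₁ + μ₂ ≠ 0) :
    cubeGamma₁ t < 0 ∧ 0 < cubeGamma₀ t ∧ 0 < cubeRatioDen t ∧
      (IsCentralConfiguration (nestedCubesMass μ₁ μ₂) (nestedCubes o e a t) ↔
        μ₁ / μ₂ = -(cubeRatioNum t / cubeRatioDen t)) := by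
  have hP := pull_sum_lt ht₀ ht₁
  have hG := innerPull_mul_outerPull_lt ht₀ ht₁
  have hO := outerPull_lt ht₀ ht₁
  have hI : selfPull < innerPull t := by
    linarith [innerPull_gt ht₀ ht₁, selfPull_bounds.2]
  have g1 := cubeGamma₁_eq ht₀ ht₁
  have g0 := cubeGamma₀_eq ht₀ ht₁
  rw [isCentralConfiguration_nestedCubes_iff o e ha hM, cubePull_one_one, cubePull_self ht₀,
    cubePull_inner ht₀ ht₁, cubePull_outer ht₀ ht₁, cubeRatioNum_eq ht₀ ht₁, cubeRatioDen_eq,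
    cubeC, g0, g1]
  generalize selfPull = α at *
  generalize innerPull t = β at *
  generalize outerPull t = δ at *
  have hP' : 0 < α * t + α / t ^ 2 - β * t - δ := by linarith
  have hP0 := hP'.ne'
  -- Here α² / t² - β δ - α P = (β - α)(α t - δ), since the α² / t² terms cancel; in `hnum`,
  -- subtracting β P instead cancels β δ.
  have hden : 24 * (-(9 * (α ^ 2 / t ^ 2 - β * δ)) /
      (-72 * (α * t + α / t ^ 2 - β * t - δ))) - 3 * α =
      3 * ((β - α) * (α * t - δ)) / (α * t + α / t ^ 2 - β * t - δ) := by
    rw [neg_mul, neg_div_neg_eq]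
    rw [eq_div_iff hP0, sub_mul, ← mul_div_assoc, div_mul_eq_mul_div,
      show (24 * (9 * (α ^ 2 / t ^ 2 - β * δ)) * (α * t + α / t ^ 2 - β * t - δ)) /
        (72 * (α * t + α / t ^ 2 - β * t - δ)) = 3 * (α ^ 2 / t ^ 2 - β * δ) by
        rw [div_eq_iff (by positivity)]; ring]
    ring
  have hnum : 24 * (-(9 * (α ^ 2 / t ^ 2 - β * δ)) /
      (-72 * (α * t + α / t ^ 2 - β * t - δ))) - 3 * β =
      3 * ((β - α) * (β * t - α / t ^ 2)) / (α * t + α / t ^ 2 - β * t - δ) := by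
    rw [neg_mul, neg_div_neg_eq]
    rw [eq_div_iff hP0, sub_mul, ← mul_div_assoc, div_mul_eq_mul_div,
      show (24 * (9 * (α ^ 2 / t ^ 2 - β * δ)) * (α * t + α / t ^ 2 - β * t - δ)) /
        (72 * (α * t + α / t ^ 2 - β * t - δ)) = 3 * (α ^ 2 / t ^ 2 - β * δ) by
        rw [div_eq_iff (by positivity)]; ring]
    ring
  have hβ : 0 < β - α := by linarith
  have hδ : 0 < α * t - δ := by linarith
  have hcc : (∃ l : ℝ, -l = μ₁ * -α + μ₂ * -β ∧ -l * t = μ₁ * -δ + μ₂ * (-α / t ^ 2)) ↔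
      μ₁ * (α * t - δ) = -((β * t - α / t ^ 2) * μ₂) := by
    constructor
    · rintro ⟨l, h1, h2⟩
      rw [h1] at h2
      linear_combination -h2
    · intro h
      refine ⟨μ₁ * α + μ₂ * β, by ring, by linear_combination -h⟩
  refine ⟨by nlinarith, by linarith, ?_, ?_⟩
  · rw [hden]
    positivity
  · rw [hden, hnum, div_div_div_cancel_right₀ hP0, mul_div_mul_left _ _ (by norm_num),
      mul_div_mul_left _ _ hβ.ne', hcc, ← neg_div, div_eq_div_iff hμ₂ hδ.ne', neg_mul]
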